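/- Let $M=p_1^{n_1}p_2^{n_2}\cdots p_K^{n_K}$, where $p_1,\dots,p_K$ are distinct primes and $n_1,\dots,n_K\ge 1$ are integers. Let $A,B\subset\mathbb{Z}_M=\mathbb{Z}/M\mathbb{Z}$ satisfy $A\oplus B=\mathbb{Z}_M$, that is, every element of $\mathbb{Z}_M$ can be written uniquely as $a+b$ with $a\in A$, $b\in B$. For $A\subset\mathbb{Z}_M$, identify the residue classes mod $M$ with $\{0,1,\dots,M-1\}$, let $A(X)=\sum_{a\in A}X^a\in\mathbb{Z}[X]$, let $\Phi_s(X)$ be the $s$-th cyclotomic polynomial, and let $S_A$ be the set of prime powers $p^\alpha$ ($p$ prime, $\alpha\ge 1$) such that $\Phi_{p^\alpha}(X)$ divides $A(X)$. We say that $A$ satisfies (T2) if, whenever $k\ge 1$ and $s_1,\dots,s_k\in S_A$ are powers of different primes, the polynomial $\Phi_{s_1\cdots s_k}(X)$ divides $A(X)$; similarly for $B$. Assume that for each $i\ge 3$ the prime $p_i$ divides at most one of $|A|$ and $|B|$. Then both $A$ and $B$ satisfy (T2). Moreover, the assumption on the primes $p_i$, $i\ge3$, holds in particular whenever $n_i=1$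 for all $i\notin\{1,2\}$. -/

import Mathlib

open Polynomial

namespace CyclicTiling

/-- The tiling relation `A ⊕ B = ℤ_M`: every element of `ℤ_M` is uniquely `a + b` with
`a ∈ A` and `b ∈ B`. -/
def IsTiling {M : ℕ} (A B : Finset (ZMod M)) : Prop :=
  AddSubgroup.IsComplement (A : Set (ZMod M)) (B : Set (ZMod M))

/-- The mask polynomial `A(X) = ∑_{a ∈ A} X ^ a` in `ℤ[X]`, where each residue class is represented
by its representative in `{0, …, M - 1}` (for `M ≠ 0`). -/
noncomputable def maskPoly {M : ℕ} (A : Finset (ZMod M)) : ℤ[X] :=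
  ∑ a ∈ A, X ^ a.val

/-- The set `S_A` of prime powers `s = p ^ α`, `α ≥ 1`, such that the cyclotomic polynomial `Φ_s`
divides `A(X)`. -/
def primePowerDivisors {M : ℕ} (A : Finset (ZMod M)) : Set ℕ :=
  {s | IsPrimePow s ∧ cyclotomic s ℤ ∣ maskPoly A}

/-- Condition (T2): if `s_1, …, s_k ∈ S_A`, `k ≥ 1`, are powers of different primes, then
`Φ_{s_1 ⋯ s_k}` divides `A(X)`. Here `P` is the finite set of the different primes involved, and
the prime power belonging to `q ∈ P` is `q ^ α q`. -/
def SatisfiesT2 {M : ℕ} (A : Finset (ZMod M)) : Prop :=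
  ∀ (P : Finset ℕ) (α : ℕ → ℕ), P.Nonempty → (∀ q ∈ P, q.Prime) →
    (∀ q ∈ P, q ^ α q ∈ primePowerDivisors A) →
      cyclotomic (∏ q ∈ P, q ^ α q) ℤ ∣ maskPoly A

end CyclicTiling

open Finset

namespace CyclicTiling

/-! The proof is a strong induction on `M`, under a hypothesis that survives the reduction: at most
two primes divide both cardinalities. If one tile lies in a residue class modulo a prime `p ∣ M`,
that tile and each slice modulo `p` of the other tile `ℤ_{M/p}` (`Tiles.tiles_slice`), and (T2)
lifts back from these smaller tilings (`NatT2.of_slice`, `Tiles.natT2_of_slices`). Such a class is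
always within reach. If a prime `p ∣ M` misses `|B|`, Tijdeman's theorem replaces `B` by `pB`, which
lies in the class `0`, and (T2) descends from `pB` to `B`; symmetrically for `A`. Otherwise every
prime factor of `M` divides both cardinalities, so there are at most two of them and Sands' theorem
(`Tiles.exists_mod_eq`) applies. -/

/-- The polynomial `∑_{a ∈ A} X ^ a` of a finite set of natural numbers. -/
noncomputable def natMask (A : Finset ℕ) : ℤ[X] := ∑ a ∈ A, X ^ a

/-- The finite sets `A`, `B` of natural numbers tile `ℤ_M`: they have `M` sums, which are pairwise
distinct modulo `M`. -/
def Tiles (M : ℕ) (A B : Finset ℕ) : Prop :=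
  A.card * B.card = M ∧ ∀ a ∈ A, ∀ a' ∈ A, ∀ b ∈ B, ∀ b' ∈ B,
    a + b ≡ a' + b' [MOD M] → a = a' ∧ b = b'

/-- Condition (T2), indexed by the product `s` of the prime powers involved. -/
def NatT2 (A : Finset ℕ) : Prop :=
  ∀ s, 1 < s → (∀ q, q.Prime → q ∣ s → cyclotomic (q ^ s.factorization q) ℤ ∣ natMask A) →
    cyclotomic s ℤ ∣ natMask A

/-- The points of `B` congruent to `j` modulo `p`, divided by `p`. -/
def slice (p j : ℕ) (B : Finset ℕ) : Finset ℕ := {b ∈ B | b % p = j}.image (· / p)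

/-! ### Cyclotomic divisors of mask polynomials -/

theorem aeval_natMask (A : Finset ℕ) (ζ : ℂ) : aeval ζ (natMask A) = ∑ a ∈ A, ζ ^ a := by
  simp [natMask]

theorem eval_one_natMask (A : Finset ℕ) : (natMask A).eval 1 = A.card := by
  simp [natMask, eval_finsetSum]

theorem cyclotomic_dvd_natMask_iff {n : ℕ} (hn : 0 < n) {ζ : ℂ} (h : IsPrimitiveRoot ζ n)
    (A : Finset ℕ) : cyclotomic n ℤ ∣ natMask A ↔ ∑ a ∈ A, ζ ^ a = 0 := by
  rw [cyclotomic_eq_minpoly h hn, ← minpoly.isIntegrallyClosed_dvd_iff (h.isIntegral hn),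
    aeval_natMask]

theorem not_cyclotomic_one_dvd_natMask {A : Finset ℕ} (hA : A.Nonempty) :
    ¬ cyclotomic 1 ℤ ∣ natMask A := by
  rw [cyclotomic_dvd_natMask_iff one_pos IsPrimitiveRoot.one]
  simpa using hA.ne_empty

namespace Tiles

variable {M : ℕ} {A B : Finset ℕ}

theorem symm (h : Tiles M A B) : Tiles M B A := by
  refine ⟨by rw [mul_comm, h.1], fun b hb b' hb' a ha a' ha' hab => ?_⟩
  have := h.2 a ha a' ha' b hb b' hb' (by rwa [add_comm a, add_comm a'])
  exact ⟨this.2, this.1⟩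

theorem nonempty_left (h : Tiles M A B) (hM : 0 < M) : A.Nonempty := by
  rw [← card_pos]
  exact Nat.pos_of_mul_pos_right (h.1 ▸ hM)

/-- The sums modulo `M` enumerate the residues. -/
theorem sum_eq_sum_range {R : Type*} [AddCommMonoid R] (h : Tiles M A B) (hM : 0 < M) (f : ℕ → R) :
    ∑ x ∈ A ×ˢ B, f ((x.1 + x.2) % M) = ∑ i ∈ range M, f i := by
  have hinj : Set.InjOn (fun x : ℕ × ℕ => (x.1 + x.2) % M) (A ×ˢ B : Finset (ℕ × ℕ)) := by
    rintro ⟨a, b⟩ hx ⟨a', b'⟩ hy hxy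
    simp only [coe_product, Set.mem_prod, mem_coe] at hx hy
    have := h.2 a hx.1 a' hy.1 b hx.2 b' hy.2 hxy
    simp [this]
  have him : (A ×ˢ B).image (fun x : ℕ × ℕ => (x.1 + x.2) % M) = range M := by
    refine eq_of_subset_of_card_le ?_ ?_
    · intro i hi
      obtain ⟨x, -, rfl⟩ := mem_image.1 hi
      exact mem_range.2 (Nat.mod_lt _ hM)
    · rw [card_image_of_injOn hinj, card_product, h.1, card_range]
  rw [← him, sum_image hinj]

/-- At a primitive `s`-th root of unity `ζ`, `A(ζ)B(ζ)` is the full geometric sum over the residues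
mod `M`, which vanishes. -/
theorem cyclotomic_dvd_or (h : Tiles M A B) (hM : 0 < M) {s : ℕ} (hs : s ∣ M) (hs1 : s ≠ 1) :
    cyclotomic s ℤ ∣ natMask A ∨ cyclotomic s ℤ ∣ natMask B := by
  have hs0 : 0 < s := Nat.pos_of_dvd_of_pos hs hM
  have hζ := Complex.isPrimitiveRoot_exp s hs0.ne'
  set ζ := Complex.exp (2 * Real.pi * Complex.I / s)
  rw [cyclotomic_dvd_natMask_iff hs0 hζ, cyclotomic_dvd_natMask_iff hs0 hζ, ← mul_eq_zero,
    sum_mul_sum, ← sum_product' A B (fun a b => ζ ^ a * ζ ^ b)]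
  have hζM : ζ ^ M = 1 := (hζ.pow_eq_one_iff_dvd M).2 hs
  have h1 : ζ ≠ 1 := hζ.ne_one (by omega)
  calc ∑ x ∈ A ×ˢ B, ζ ^ x.1 * ζ ^ x.2 = ∑ x ∈ A ×ˢ B, ζ ^ ((x.1 + x.2) % M) :=
        sum_congr rfl fun x _ => by rw [← pow_add, pow_eq_pow_mod _ hζM]
    _ = ∑ i ∈ range M, ζ ^ i := h.sum_eq_sum_range hM _
    _ = 0 := by rw [geom_sum_eq h1, hζM, sub_self, zero_div]

end Tiles

/-- Distinct cyclotomic polynomials are coprime, so their product divides `A(X)`; evaluate at `1`,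
where each factor is `p`. -/
theorem pow_card_dvd_card {p : ℕ} (hp : p.Prime) (A : Finset ℕ) (E : Finset ℕ)
    (hE : ∀ α ∈ E, 0 < α ∧ cyclotomic (p ^ α) ℤ ∣ natMask A) : p ^ E.card ∣ A.card := by
  have := Fact.mk hp
  have hdvd : ∏ α ∈ E, cyclotomic (p ^ α) ℤ ∣ natMask A := by
    refine Finset.prod_dvd_of_isRelPrime ?_ fun α hα => (hE α hα).2
    intro α _ β _ hαβ
    refine (cyclotomic.irreducible (pow_pos hp.pos _)).isRelPrime_iff_not_dvd.2 fun hd => ?_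
    have has := (cyclotomic.irreducible (pow_pos hp.pos _)).associated_of_dvd
      (cyclotomic.irreducible (pow_pos hp.pos _)) hd
    have := eq_of_monic_of_associated (cyclotomic.monic _ ℤ) (cyclotomic.monic _ ℤ) has
    exact hαβ (Nat.pow_right_injective hp.two_le (cyclotomic_injective this))
  have := eval_dvd (x := 1) hdvd
  rw [eval_one_natMask, eval_prod, prod_congr rfl (g := fun _ => (p : ℤ)), prod_const] at this
  · exact_mod_cast this
  · intro α hα
    obtain ⟨k, rfl⟩ := Nat.exists_eq_succ_of_ne_zero (hE α hα).1.ne'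
    exact eval_one_cyclotomic_prime_pow k

theorem prime_dvd_card {p α : ℕ} (hp : p.Prime) (hα : 0 < α) {A : Finset ℕ}
    (h : cyclotomic (p ^ α) ℤ ∣ natMask A) : p ∣ A.card := by
  simpa using pow_card_dvd_card hp A {α} (by simpa using ⟨hα, h⟩)

namespace Tiles

variable {M : ℕ} {A B : Finset ℕ}

/-- A cyclotomic polynomial of prime power order divides at most one of the two mask polynomials,
and neither of them unless the order divides `M`. -/
theorem prime_pow_dvd_and_not_dvd (h : Tiles M A B) (hM : 0 < M) {p α : ℕ} (hp : p.Prime)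
    (hα : 0 < α) (hA : cyclotomic (p ^ α) ℤ ∣ natMask A) :
    p ^ α ∣ M ∧ ¬ cyclotomic (p ^ α) ℤ ∣ natMask B := by
  classical
  set n := M.factorization p with hn
  -- The exponents `1, …, n` are covered by `E A ∪ E B`, while the two sizes add up to at most `n`;
  -- hence the union is exact and disjoint. The bound `max n α` keeps `α` in range before `α ≤ n` is
  -- known.
  let E : Finset ℕ → Finset ℕ := fun C =>
    {β ∈ Icc 1 (max n α) | cyclotomic (p ^ β) ℤ ∣ natMask C}
  have hE : ∀ C, ∀ β ∈ E C, 0 < β ∧ cyclotomic (p ^ β) ℤ ∣ natMask C := fun C β hβ => by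
    simp only [E, mem_filter, mem_Icc] at hβ
    exact ⟨hβ.1.1, hβ.2⟩
  have hle : (E A).card + (E B).card ≤ n := by
    rw [hn, ← hp.pow_dvd_iff_le_factorization hM.ne', pow_add, ← h.1]
    exact mul_dvd_mul (pow_card_dvd_card hp A _ (hE A)) (pow_card_dvd_card hp B _ (hE B))
  have hsub : Icc 1 n ⊆ E A ∪ E B := fun β hβ => by
    rw [mem_Icc] at hβ
    have := h.cyclotomic_dvd_or hM (s := p ^ β)
      ((hp.pow_dvd_iff_le_factorization hM.ne').2 hβ.2)
      (Nat.one_lt_pow (by omega) hp.one_lt).ne'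
    simp only [E, mem_union, mem_filter, mem_Icc]
    have hle' : β ≤ max n α := le_max_of_le_left hβ.2
    tauto
  have hαA : α ∈ E A := by
    simp only [E, mem_filter, mem_Icc]
    exact ⟨⟨hα, le_max_right _ _⟩, hA⟩
  have hcard := card_union_add_card_inter (E A) (E B)
  have hn1 := card_le_card hsub
  have hIcc : (Icc 1 n).card = n := by simp
  refine ⟨?_, fun hB => ?_⟩
  · have heq := eq_of_subset_of_card_le hsub (by omega)
    have : α ∈ Icc 1 n := heq ▸ mem_union_left _ hαA
    exact (hp.pow_dvd_iff_le_factorization hM.ne').2 (mem_Icc.1 this).2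
  · have hαB : α ∈ E B := by
      simp only [E, mem_filter, mem_Icc]
      exact ⟨⟨hα, le_max_right _ _⟩, hB⟩
    have : 0 < (E A ∩ E B).card := card_pos.2 ⟨α, mem_inter.2 ⟨hαA, hαB⟩⟩
    omega

/-! ### Dilations of a tile -/

/-- Tijdeman's theorem for a prime dilation. -/
theorem dilate_prime (h : Tiles M A B) (hM : 0 < M) {r : ℕ} (hr : r.Prime) (hrB : ¬ r ∣ B.card) :
    Tiles M A (B.image (r * ·)) := by
  classical
  have := Fact.mk hr
  have : NeZero M := ⟨hM.ne'⟩
  have : CharP (AddMonoidAlgebra (ZMod r) (ZMod M)) r :=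
    charP_of_injective_algebraMap
      (algebraMap (ZMod r) (AddMonoidAlgebra (ZMod r) (ZMod M))).injective r
  let e : ZMod M → AddMonoidAlgebra (ZMod r) (ZMod M) := fun g => AddMonoidAlgebra.single g 1
  have he : ∀ g g', e g * e g' = e (g + g') := fun g g' => by
    simp only [e, AddMonoidAlgebra.single_mul_single, mul_one]
  have hepow : ∀ g, ∀ m : ℕ, e g ^ m = e (m • g) := fun g m => by
    simp only [e, AddMonoidAlgebra.single_pow, one_pow]
  have hN : (∑ a ∈ A, e a) * ∑ b ∈ B, e b = ∑ g, e g := by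
    have hrange : ∑ i ∈ range M, e (i : ZMod M) = ∑ g, e g :=
      sum_nbij' (fun i => (i : ZMod M)) ZMod.val (by simp)
        (fun g _ => mem_range.2 (ZMod.val_lt g))
        (fun i hi => ZMod.val_cast_of_lt (mem_range.1 hi)) (by simp) (by simp)
    rw [sum_mul_sum, ← sum_product' A B (fun a b => e a * e b), ← hrange,
      ← h.sum_eq_sum_range hM fun i => e (i : ZMod M)]
    exact sum_congr rfl fun x _ => by rw [he, ZMod.natCast_mod, Nat.cast_add]
  have heN : ∀ g, e g * ∑ g', e g' = ∑ g', e g' := fun g => by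
    rw [mul_sum, ← Equiv.sum_comp (Equiv.addLeft g) e]
    exact sum_congr rfl fun g' _ => he g g'
  have hBN : ∀ m : ℕ, (∑ b ∈ B, e b) ^ m * ∑ g, e g = ((B.card : ZMod r) ^ m) • ∑ g, e g := by
    intro m
    induction m with
    | zero => simp
    | succ m ih =>
      rw [pow_succ', mul_assoc, ih, mul_smul_comm, sum_mul, sum_congr rfl fun (b : ℕ) _ => heN b,
        sum_const, ← Nat.cast_smul_eq_nsmul (ZMod r), smul_smul, pow_succ]
  -- In characteristic `r`, Frobenius turns `B ^ r` into the dilate of `B`. With `N` the sum of all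
  -- group elements, `A * B ^ r = N * B ^ (r - 1) = |B| ^ (r - 1) N = N` by Fermat.
  have hkey : (∑ a ∈ A, e a) * ∑ b ∈ B, e (r • (b : ZMod M)) = ∑ g, e g := by
    have h1 : ∑ b ∈ B, e (r • (b : ZMod M)) = (∑ b ∈ B, e b) * (∑ b ∈ B, e b) ^ (r - 1) := by
      rw [← pow_succ', Nat.sub_add_cancel hr.one_le, sum_pow_char]
      exact sum_congr rfl fun b _ => (hepow b r).symm
    have h3 : (B.card : ZMod r) ≠ 0 := by rwa [Ne, ZMod.natCast_eq_zero_iff]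
    rw [h1, ← mul_assoc, hN, mul_comm, hBN, ZMod.pow_card_sub_one_eq_one h3, one_smul]
  have him : (A ×ˢ B.image (r * ·)).image (fun x : ℕ × ℕ => ((x.1 + x.2 : ℕ) : ZMod M)) =
      univ := by
    -- An element missed by the sums would have coefficient `0` on the left and `1` on the right.
    refine eq_univ_iff_forall.2 fun g => by_contra fun hg => ?_
    have hcoeff := congrArg (fun f => f.coeff g) hkey
    simp only [sum_mul_sum, he, e, AddMonoidAlgebra.coeff_sum, AddMonoidAlgebra.coeff_single,
      Finsupp.finsetSum_apply, Finsupp.single_apply, sum_ite_eq', mem_univ, if_true] at hcoeff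
    refine zero_ne_one (hcoeff ▸ (sum_eq_zero fun a ha => sum_eq_zero fun b hb => if_neg ?_).symm)
    rintro rfl
    refine hg (mem_image.2 ⟨(a, r * b), mem_product.2 ⟨ha, mem_image_of_mem _ hb⟩, ?_⟩)
    simp
  have hcardB : (B.image (r * ·)).card = B.card :=
    card_image_of_injective _ (mul_right_injective₀ hr.ne_zero)
  have hcard : A.card * (B.image (r * ·)).card = M := by rw [hcardB, h.1]
  refine ⟨hcard, fun a ha a' ha' b hb b' hb' hab => ?_⟩
  have hinj : Set.InjOn (fun x : ℕ × ℕ => ((x.1 + x.2 : ℕ) : ZMod M))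
      (A ×ˢ B.image (r * ·) : Finset (ℕ × ℕ)) := by
    rw [← card_image_iff, him, card_univ, ZMod.card, card_product, hcard]
  have := hinj (mem_coe.2 (mem_product.2 ⟨ha, hb⟩ : (a, b) ∈ _))
    (mem_coe.2 (mem_product.2 ⟨ha', hb'⟩ : (a', b') ∈ _)) ((ZMod.natCast_eq_natCast_iff _ _ _).2 hab)
  exact Prod.mk_inj.1 this

/-- Tijdeman's theorem. -/
theorem dilate (hM : 0 < M) {r : ℕ} (hr0 : r ≠ 0) (h : Tiles M A B) (hr : r.Coprime B.card) :
    Tiles M A (B.image (r * ·)) := by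
  induction r using induction_on_primes with
  | zero => exact absurd rfl hr0
  | one => simpa using h
  | prime_mul p n hp ih =>
    have hn0 : n ≠ 0 := right_ne_zero_of_mul hr0
    have hcard : (B.image (n * ·)).card = B.card :=
      card_image_of_injective _ (mul_right_injective₀ hn0)
    have := (ih hn0 (Nat.Coprime.coprime_mul_left hr)).dilate_prime hM hp
      (by rw [hcard]; exact (hp.coprime_iff_not_dvd).1 (Nat.Coprime.coprime_mul_right hr))
    rwa [image_image, show (p * ·) ∘ (n * ·) = (p * n * ·) from
      funext fun x => (mul_assoc p n x).symm] at this

end Tiles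

/-! ### Sands' theorem -/

theorem exists_coprime_sub {M u v : ℕ} (hM : M ≠ 1) (huv : ∀ r, r.Prime → r ∣ M → r = u ∨ r = v)
    {C : Finset ℕ} (hC : ∀ p, p.Prime → p ∣ M → ∀ c, ∃ x ∈ C, x % p ≠ c) :
    ∃ x ∈ C, ∃ y ∈ C, ((x : ℤ) - y).natAbs.Coprime M := by
  -- Replace the given `u`, `v` by genuine prime factors of `M`, possibly equal.
  obtain ⟨u, v, ⟨hu, huM⟩, ⟨hv, hvM⟩, huv⟩ : ∃ u v, (u.Prime ∧ u ∣ M) ∧ (v.Prime ∧ v ∣ M) ∧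
      ∀ r, r.Prime → r ∣ M → r = u ∨ r = v := by
    obtain ⟨r, hr, hrM⟩ := Nat.exists_prime_and_dvd hM
    by_cases h1 : u.Prime ∧ u ∣ M
    · by_cases h2 : v.Prime ∧ v ∣ M
      · exact ⟨u, v, h1, h2, huv⟩
      · refine ⟨u, u, h1, h1, fun q hq hqM => (huv q hq hqM).imp_right ?_⟩
        rintro rfl
        exact absurd ⟨hq, hqM⟩ h2
    · have key : ∀ q, q.Prime → q ∣ M → q = v := fun q hq hqM =>
        (huv q hq hqM).resolve_left fun h => h1 (h ▸ ⟨hq, hqM⟩)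
      have hv : v.Prime ∧ v ∣ M := key r hr hrM ▸ ⟨hr, hrM⟩
      exact ⟨v, v, hv, hv, fun q hq hqM => Or.inl (key q hq hqM)⟩
  have hcop : ∀ x y : ℕ, x % u ≠ y % u → x % v ≠ y % v → ((x : ℤ) - y).natAbs.Coprime M := by
    intro x y hxu hxv
    refine Nat.coprime_of_dvd fun r hr hrxy hrM => ?_
    have hmod : x % r = y % r :=
      ((Nat.modEq_iff_dvd (n := r) (a := y) (b := x)).2 (Int.natCast_dvd.2 hrxy)).symm
    rcases huv r hr hrM with rfl | rfl
    exacts [hxu hmod, hxv hmod]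
  -- The class `u` is never a remainder mod `u`; it only serves to produce an element.
  obtain ⟨x₀, h0, -⟩ := hC u hu huM u
  obtain ⟨x₁, h1, hx1⟩ := hC u hu huM (x₀ % u)
  obtain ⟨x₂, h2, hx2⟩ := hC v hv hvM (x₀ % v)
  -- If neither `x₁` nor `x₂` pairs with `x₀`, each agrees with `x₀` modulo the other prime, so they
  -- pair with each other.
  by_cases h10 : x₁ % v = x₀ % v
  · by_cases h20 : x₂ % u = x₀ % u
    · exact ⟨x₁, h1, x₂, h2, hcop _ _ (by rwa [h20]) (by rw [h10]; exact hx2.symm)⟩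
    · exact ⟨x₂, h2, x₀, h0, hcop _ _ h20 hx2⟩
  · exact ⟨x₁, h1, x₀, h0, hcop _ _ hx1 h10⟩

theorem isUnit_sub_of_coprime {M x y : ℕ} (h : ((x : ℤ) - y).natAbs.Coprime M) :
    IsUnit ((x : ZMod M) - y) := by
  have h1 := (ZMod.isUnit_iff_coprime _ M).2 h
  have h2 : ((x : ZMod M) - y) = (((x : ℤ) - y : ℤ) : ZMod M) := by push_cast; rfl
  rw [h2]
  rcases Int.natAbs_eq ((x : ℤ) - y) with h3 | h3 <;> rw [h3] <;> simpa using h1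

/-- Sands' theorem: if `M` has at most two prime factors, then one of the tiles lies in a residue
class modulo a prime factor of `M`. -/
theorem Tiles.exists_mod_eq {M : ℕ} {A B : Finset ℕ} (h : Tiles M A B) (hM : 1 < M) {u v : ℕ}
    (huv : ∀ r, r.Prime → r ∣ M → r = u ∨ r = v) :
    ∃ p c, p.Prime ∧ p ∣ M ∧ ((∀ a ∈ A, a % p = c) ∨ ∀ b ∈ B, b % p = c) := by
  by_contra! hcon
  have : NeZero M := ⟨by omega⟩
  have : Fact (1 < M) := ⟨hM⟩
  obtain ⟨a, ha, a', ha', hu⟩ := exists_coprime_sub hM.ne' huv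
    (C := A) fun p hp hpM c => (hcon p c hp hpM).1
  obtain ⟨b, hb, b', hb', hv⟩ := exists_coprime_sub hM.ne' huv
    (C := B) fun p hp hpM c => (hcon p c hp hpM).2
  obtain ⟨U, hU⟩ := isUnit_sub_of_coprime hu
  obtain ⟨V, hV⟩ := isUnit_sub_of_coprime hv
  -- With this ratio `a + r b' = a' + r b`, two representations in the tiling by `A` and `rB`.
  set r := ((U * V⁻¹ : (ZMod M)ˣ) : ZMod M).val with hr
  have hrM : r.Coprime M := ZMod.val_coe_unit_coprime _
  have hr0 : r ≠ 0 := fun h0 => by simp [h0] at hrM; omega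
  have hr' : (r : ZMod M) * (b - b') = a - a' := by
    rw [hr, ZMod.natCast_val, ZMod.cast_id, ← hU, ← hV]
    simp
  have ht := h.dilate (by omega) hr0 (hrM.coprime_dvd_right (Dvd.intro_left _ h.1))
  have := (ht.2 a ha a' ha' _ (mem_image_of_mem _ hb') _ (mem_image_of_mem _ hb) (by
    rw [← ZMod.natCast_eq_natCast_iff]
    push_cast
    linear_combination -hr')).1
  rw [this, sub_self] at hU
  exact U.ne_zero hU

/-! ### Slices modulo a prime and the transfer of (T2) -/

theorem mem_slice {p j x : ℕ} {B : Finset ℕ} :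
    x ∈ slice p j B ↔ ∃ b ∈ B, b % p = j ∧ b / p = x := by
  simp [slice, and_assoc]

theorem injOn_div_filter (p j : ℕ) (B : Finset ℕ) :
    Set.InjOn (· / p) ({b ∈ B | b % p = j} : Finset ℕ) := by
  intro x hx y hy hxy
  simp only [coe_filter, Set.mem_ofPred_eq] at hx hy hxy
  rw [← Nat.div_add_mod x p, ← Nat.div_add_mod y p, hxy, hx.2, hy.2]

theorem card_slice (p j : ℕ) (B : Finset ℕ) : (slice p j B).card = #{b ∈ B | b % p = j} :=
  card_image_of_injOn (injOn_div_filter p j B)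

theorem card_slice_of_mod_eq {p c : ℕ} {A : Finset ℕ} (hc : ∀ a ∈ A, a % p = c) :
    (slice p c A).card = A.card := by
  rw [card_slice, filter_true_of_mem hc]

theorem sum_filter_pow_eq (p j : ℕ) (B : Finset ℕ) (ζ : ℂ) :
    ∑ b ∈ B with b % p = j, ζ ^ b = ζ ^ j * ∑ x ∈ slice p j B, (ζ ^ p) ^ x := by
  rw [slice, sum_image (injOn_div_filter p j B), mul_sum]
  refine sum_congr rfl fun b hb => ?_
  rw [← (mem_filter.1 hb).2, ← pow_mul, ← pow_add, Nat.mod_add_div]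

section transfer

variable {p s t : ℕ}

/-- Here `A(X) = X^c A'(X^p)`. The relation `hst` holds for `t = s` when `p ∤ s`, and for `s = p t`.
-/
theorem cyclotomic_dvd_iff_slice (hs : 0 < s) (ht : 0 < t)
    (hst : ∀ ζ : ℂ, IsPrimitiveRoot ζ s → IsPrimitiveRoot (ζ ^ p) t) {c : ℕ} {A : Finset ℕ}
    (hc : ∀ a ∈ A, a % p = c) :
    cyclotomic s ℤ ∣ natMask A ↔ cyclotomic t ℤ ∣ natMask (slice p c A) := by
  have hζ := Complex.isPrimitiveRoot_exp s hs.ne'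
  rw [cyclotomic_dvd_natMask_iff hs hζ, cyclotomic_dvd_natMask_iff ht (hst _ hζ)]
  have := sum_filter_pow_eq p c A (Complex.exp (2 * Real.pi * Complex.I / s))
  rw [filter_true_of_mem hc] at this
  rw [this, mul_eq_zero, or_iff_right (pow_ne_zero _ (hζ.ne_zero hs.ne'))]

theorem cyclotomic_dvd_of_slices (hp : 0 < p) (hs : 0 < s) (ht : 0 < t)
    (hst : ∀ ζ : ℂ, IsPrimitiveRoot ζ s → IsPrimitiveRoot (ζ ^ p) t) {B : Finset ℕ}
    (h : ∀ j < p, cyclotomic t ℤ ∣ natMask (slice p j B)) : cyclotomic s ℤ ∣ natMask B := by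
  have hζ := Complex.isPrimitiveRoot_exp s hs.ne'
  rw [cyclotomic_dvd_natMask_iff hs hζ, ← sum_fiberwise_of_maps_to (s := B) (t := range p)
    (g := (· % p)) fun b _ => mem_range.2 (Nat.mod_lt b hp)]
  refine sum_eq_zero fun j hj => ?_
  rw [sum_filter_pow_eq, (cyclotomic_dvd_natMask_iff ht (hst _ hζ) _).1 (h j (mem_range.1 hj)),
    mul_zero]

theorem isPrimitiveRoot_pow_of_not_dvd (hp : p.Prime) (hs : ¬ p ∣ s) (ζ : ℂ)
    (h : IsPrimitiveRoot ζ s) : IsPrimitiveRoot (ζ ^ p) s :=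
  h.pow_of_coprime p ((hp.coprime_iff_not_dvd).2 hs)

theorem isPrimitiveRoot_pow_of_mul (hp : p.Prime) (ζ : ℂ) (h : IsPrimitiveRoot ζ (p * t)) :
    IsPrimitiveRoot (ζ ^ p) t := by
  simpa [Nat.mul_div_cancel_left t hp.pos] using h.pow_of_dvd hp.ne_zero (dvd_mul_right p t)

theorem factorization_prime_mul_self (hp : p.Prime) (ht : t ≠ 0) :
    (p * t).factorization p = t.factorization p + 1 := by
  rw [Nat.factorization_mul hp.ne_zero ht, Finsupp.add_apply, hp.factorization_self, add_comm]

theorem factorization_prime_mul_of_ne (hp : p.Prime) (ht : t ≠ 0) {q : ℕ} (hq : q ≠ p) :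
    (p * t).factorization q = t.factorization q := by
  rw [Nat.factorization_mul hp.ne_zero ht, Finsupp.add_apply, hp.factorization,
    Finsupp.single_eq_of_ne hq, zero_add]

end transfer

theorem not_dvd_prime_pow {p q : ℕ} (hp : p.Prime) (hq : q.Prime) (hqp : q ≠ p) (k : ℕ) :
    ¬ p ∣ q ^ k := fun h =>
  hqp ((Nat.prime_dvd_prime_iff_eq hp hq).1 (hp.dvd_of_dvd_pow h)).symm

/-- Condition (T2) lifts from `A'` to `c + p A'`. -/
theorem NatT2.of_slice {p c : ℕ} (hp : p.Prime) {A : Finset ℕ} (hA : A.Nonempty)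
    (hc : ∀ a ∈ A, a % p = c) (h : NatT2 (slice p c A)) : NatT2 A := by
  have hne : (slice p c A).Nonempty := by
    rw [← card_pos, card_slice_of_mod_eq hc]
    exact card_pos.2 hA
  have hcop : ∀ s, 0 < s → ¬ p ∣ s →
      (cyclotomic s ℤ ∣ natMask A ↔ cyclotomic s ℤ ∣ natMask (slice p c A)) := fun s hs hps =>
    cyclotomic_dvd_iff_slice hs hs (isPrimitiveRoot_pow_of_not_dvd hp hps) hc
  have hmul : ∀ t, 0 < t →
      (cyclotomic (p * t) ℤ ∣ natMask A ↔ cyclotomic t ℤ ∣ natMask (slice p c A)) := fun t ht =>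
    cyclotomic_dvd_iff_slice (Nat.mul_pos hp.pos ht) ht (isPrimitiveRoot_pow_of_mul hp) hc
  intro s hs hyp
  by_cases hps : p ∣ s
  · obtain ⟨t, rfl⟩ := hps
    have ht : 0 < t := Nat.pos_of_ne_zero fun h0 => by simp [h0] at hs
    have hpA := hyp p hp (dvd_mul_right p t)
    rw [factorization_prime_mul_self hp ht.ne', pow_succ', hmul _ (pow_pos hp.pos _)] at hpA
    have hpt : p ∣ t := by
      by_contra hpt
      rw [Nat.factorization_eq_zero_of_not_dvd hpt, pow_zero] at hpA
      exact not_cyclotomic_one_dvd_natMask hne hpA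
    rw [hmul t ht]
    refine h t (hp.one_lt.trans_le (Nat.le_of_dvd ht hpt)) fun q hq hqt => ?_
    rcases eq_or_ne q p with rfl | hqp
    · exact hpA
    · rw [← hcop _ (pow_pos hq.pos _) (not_dvd_prime_pow hp hq hqp _),
        ← factorization_prime_mul_of_ne hp ht.ne' hqp]
      exact hyp q hq (dvd_mul_of_dvd_right hqt p)
  · rw [hcop s (by omega) hps]
    refine h s hs fun q hq hqs => ?_
    have hqp : q ≠ p := fun h0 => hps (h0 ▸ hqs)
    rw [← hcop _ (pow_pos hq.pos _) (not_dvd_prime_pow hp hq hqp _)]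
    exact hyp q hq hqs

namespace Tiles

theorem card_mul_card_le {m : ℕ} (hm : 0 < m) {A B : Finset ℕ}
    (h : ∀ a ∈ A, ∀ a' ∈ A, ∀ b ∈ B, ∀ b' ∈ B, a + b ≡ a' + b' [MOD m] → a = a' ∧ b = b') :
    A.card * B.card ≤ m := by
  rw [← card_product]
  conv_rhs => rw [← card_range m]
  refine card_le_card_of_injOn (fun x => (x.1 + x.2) % m)
    (fun x _ => mem_coe.2 (mem_range.2 (Nat.mod_lt _ hm))) ?_
  rintro ⟨a, b⟩ hx ⟨a', b'⟩ hy hxy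
  simp only [coe_product, Set.mem_prod, mem_coe] at hx hy
  have := h a hx.1 a' hy.1 b hx.2 b' hy.2 hxy
  simp [this]

variable {p m c : ℕ} {A B : Finset ℕ}

/-- If `A` lies in a residue class modulo `p`, then `A` and each slice of `B` tile `ℤ_{M/p}`. -/
theorem tiles_slice (h : Tiles (p * m) A B) (hp : 0 < p) (hm : 0 < m) (hc : ∀ a ∈ A, a % p = c)
    {j : ℕ} (hj : j < p) : Tiles m (slice p c A) (slice p j B) := by
  have hinj : ∀ j, ∀ a ∈ slice p c A, ∀ a' ∈ slice p c A,
      ∀ b ∈ slice p j B, ∀ b' ∈ slice p j B,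
      a + b ≡ a' + b' [MOD m] → a = a' ∧ b = b' := by
    intro j x hx x' hx' y hy y' hy' hxy
    obtain ⟨a, ha, hac, rfl⟩ := mem_slice.1 hx
    obtain ⟨a', ha', hac', rfl⟩ := mem_slice.1 hx'
    obtain ⟨b, hb, hbj, rfl⟩ := mem_slice.1 hy
    obtain ⟨b', hb', hbj', rfl⟩ := mem_slice.1 hy'
    have key : a + b ≡ a' + b' [MOD p * m] := by
      have h1 := (Nat.ModEq.mul_left' p hxy).add_right (c + j)
      have h2 : ∀ x y, x % p = c → y % p = j → p * (x / p + y / p) + (c + j) = x + y := by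
        rintro x y rfl rfl
        conv_rhs => rw [← Nat.div_add_mod x p, ← Nat.div_add_mod y p]
        ring
      rwa [h2 a b hac hbj, h2 a' b' hac' hbj'] at h1
    obtain ⟨rfl, rfl⟩ := h.2 a ha a' ha' b hb b' hb' key
    exact ⟨rfl, rfl⟩
  refine ⟨?_, hinj j⟩
  -- Each product is at most `m` and the `p` products total `p * m`, so all are equal to `m`.
  have hsum : ∑ j ∈ range p, (slice p c A).card * (slice p j B).card =
      ∑ j ∈ range p, m := by
    rw [← mul_sum, card_slice_of_mod_eq hc, sum_congr rfl fun j _ => card_slice p j B,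
      ← card_eq_sum_card_fiberwise (f := (· % p)) (t := range p)
        fun b _ => mem_coe.2 (mem_range.2 (Nat.mod_lt b hp)), h.1, sum_const, card_range,
      smul_eq_mul]
  exact (sum_eq_sum_iff_of_le fun j _ => card_mul_card_le hm (hinj j)).1 hsum j (mem_range.2 hj)

/-- Condition (T2) lifts from the slices of `B` to `B`. -/
theorem natT2_of_slices (h : Tiles (p * m) A B) (hp : p.Prime) (hm : 0 < m)
    (hc : ∀ a ∈ A, a % p = c) (hB : ∀ j < p, NatT2 (slice p j B)) : NatT2 B := by
  have hM : 0 < p * m := Nat.mul_pos hp.pos hm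
  -- A prime-power divisor of `B` is not one of `A`, so its transfer does not divide the slice of
  -- `A`; it must divide every slice of `B`.
  have key : ∀ q k l, q.Prime → 0 < k → 0 < l → cyclotomic (q ^ k) ℤ ∣ natMask B →
      (∀ ζ : ℂ, IsPrimitiveRoot ζ (q ^ k) → IsPrimitiveRoot (ζ ^ p) (q ^ l)) →
      (q ^ k ∣ p * m → q ^ l ∣ m) → ∀ j < p, cyclotomic (q ^ l) ℤ ∣ natMask
        (slice p j B) := by
    intro q k l hq hk hl hqB hkl hdvd j hj
    obtain ⟨h1, h2⟩ := h.symm.prime_pow_dvd_and_not_dvd hM hq hk hqB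
    refine ((h.tiles_slice hp.pos hm hc hj).cyclotomic_dvd_or hm (hdvd h1)
      (Nat.one_lt_pow hl.ne' hq.one_lt).ne').resolve_left fun h3 => h2 ?_
    rwa [cyclotomic_dvd_iff_slice (pow_pos hq.pos _) (pow_pos hq.pos _) hkl hc]
  have keyne : ∀ q k, q.Prime → q ≠ p → 0 < k → cyclotomic (q ^ k) ℤ ∣ natMask B →
      ∀ j < p, cyclotomic (q ^ k) ℤ ∣ natMask (slice p j B) :=
    fun q k hq hqp hk hqB => key q k k hq hk hk hqB
      (isPrimitiveRoot_pow_of_not_dvd hp (not_dvd_prime_pow hp hq hqp k)) fun hd =>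
        Nat.Coprime.dvd_of_dvd_mul_left
          ((hp.coprime_iff_not_dvd).2 (not_dvd_prime_pow hp hq hqp k)).symm hd
  intro s hs hyp
  by_cases hps : p ∣ s
  · obtain ⟨t, rfl⟩ := hps
    have ht : 0 < t := Nat.pos_of_ne_zero fun h0 => by simp [h0] at hs
    rcases Nat.eq_or_lt_of_le ht with ht1 | ht1
    · have := hyp p hp (dvd_mul_right p t)
      rw [← ht1] at this ⊢
      simpa [hp.factorization_self] using this
    refine cyclotomic_dvd_of_slices hp.pos (by omega) ht (isPrimitiveRoot_pow_of_mul hp)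
      fun j hj => hB j hj t ht1 fun q hq hqt => ?_
    have hqB := hyp q hq (dvd_mul_of_dvd_right hqt p)
    have hpos : 0 < t.factorization q := hq.factorization_pos_of_dvd ht.ne' hqt
    rcases eq_or_ne q p with rfl | hqp
    · rw [factorization_prime_mul_self hq ht.ne'] at hqB
      refine key q _ _ hq (Nat.succ_pos _) hpos hqB ?_ ?_ j hj
      · rw [pow_succ']
        exact isPrimitiveRoot_pow_of_mul hq
      · rw [pow_succ']
        exact Nat.dvd_of_mul_dvd_mul_left hq.pos
    · rw [factorization_prime_mul_of_ne hp ht.ne' hqp] at hqB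
      exact keyne q _ hq hqp hpos hqB j hj
  · refine cyclotomic_dvd_of_slices hp.pos (by omega) (by omega)
      (isPrimitiveRoot_pow_of_not_dvd hp hps) fun j hj => hB j hj s hs fun q hq hqs => ?_
    exact keyne q _ hq (fun h0 => hps (h0 ▸ hqs))
      (hq.factorization_pos_of_dvd (by omega) hqs) (hyp q hq hqs) j hj

end Tiles

/-- Condition (T2) descends from `pB` to `B` if `p` does not divide the cardinality of `B`. -/
theorem NatT2.of_dilate {p : ℕ} (hp : p.Prime) {B : Finset ℕ} (hpB : ¬ p ∣ B.card)
    (h : NatT2 (B.image (p * ·))) : NatT2 B := by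
  have hcop : ∀ s, 0 < s → ¬ p ∣ s →
      (cyclotomic s ℤ ∣ natMask (B.image (p * ·)) ↔ cyclotomic s ℤ ∣ natMask B) := by
    intro s hs hps
    have hζ := Complex.isPrimitiveRoot_exp s hs.ne'
    rw [cyclotomic_dvd_natMask_iff hs hζ, cyclotomic_dvd_natMask_iff hs
      (isPrimitiveRoot_pow_of_not_dvd hp hps _ hζ),
      sum_image (mul_right_injective₀ hp.ne_zero).injOn]
    simp only [pow_mul]
  intro s hs hyp
  have hps : ¬ p ∣ s := fun hps =>
    hpB (prime_dvd_card hp (hp.factorization_pos_of_dvd (by omega) hps) (hyp p hp hps))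
  rw [← hcop s (by omega) hps]
  refine h s hs fun q hq hqs => ?_
  rw [hcop _ (pow_pos hq.pos _) (not_dvd_prime_pow hp hq (fun h0 => hps (h0 ▸ hqs)) _)]
  exact hyp q hq hqs

theorem natT2_of_card_eq_one {A : Finset ℕ} (hA : A.card = 1) : NatT2 A := by
  intro s hs hyp
  obtain ⟨q, hq, hqs⟩ := Nat.exists_prime_and_dvd hs.ne'
  have := prime_dvd_card hq (hq.factorization_pos_of_dvd (by omega) hqs) (hyp q hq hqs)
  rw [hA] at this
  exact absurd (Nat.dvd_one.1 this) hq.ne_one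

/-! ### The induction on `M` -/

/-- If at most two primes divide both cardinalities of a tiling, both tiles satisfy (T2). -/
theorem Tiles.natT2 {M u v : ℕ} (hM : 0 < M) {A B : Finset ℕ} (h : Tiles M A B)
    (huv : ∀ r, r.Prime → r ∣ A.card → r ∣ B.card → r = u ∨ r = v) : NatT2 A ∧ NatT2 B := by
  induction M using Nat.strong_induction_on generalizing A B with
  | _ M ih =>
  have hclass : ∀ {A B : Finset ℕ} {p c : ℕ}, Tiles M A B →
      (∀ r, r.Prime → r ∣ A.card → r ∣ B.card → r = u ∨ r = v) → p.Prime → p ∣ M →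
      (∀ a ∈ A, a % p = c) → NatT2 A ∧ NatT2 B := by
    intro A B p c h huv hp hpM hc
    obtain ⟨m, rfl⟩ := hpM
    have hm : 0 < m := Nat.pos_of_mul_pos_left hM
    have hA : 0 < A.card := card_pos.2 (h.nonempty_left hM)
    have hsl : ∀ j < p, NatT2 (slice p c A) ∧ NatT2 (slice p j B) := fun j hj => by
      have ht := h.tiles_slice hp.pos hm hc hj
      refine ih m (lt_mul_of_one_lt_left hm hp.one_lt) hm ht fun r hr hrA hrB => ?_
      have h1 := ht.1
      have h2 := h.1
      rw [card_slice_of_mod_eq hc] at h1 hrA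
      -- Slicing keeps `|A|` and divides `|B|` by `p`, so no new common prime appears.
      refine huv r hr hrA (hrB.trans ⟨p, ?_⟩)
      refine Nat.eq_of_mul_eq_mul_left hA ?_
      rw [h2, ← mul_assoc, h1, mul_comm]
    exact ⟨(hsl 0 hp.pos).1.of_slice hp (h.nonempty_left hM) hc,
      h.natT2_of_slices hp hm hc fun j hj => (hsl j hj).2⟩
  have hndvd : ∀ {A B : Finset ℕ} {p : ℕ}, Tiles M A B →
      (∀ r, r.Prime → r ∣ A.card → r ∣ B.card → r = u ∨ r = v) → p.Prime → p ∣ M →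
      ¬ p ∣ B.card → NatT2 A ∧ NatT2 B := by
    intro A B p h huv hp hpM hpB
    have hcard : (B.image (p * ·)).card = B.card :=
      card_image_of_injective _ (mul_right_injective₀ hp.ne_zero)
    have := hclass (c := 0) (h.dilate_prime hM hp hpB).symm
      (fun r hr h1 h2 => huv r hr h2 (hcard ▸ h1)) hp hpM (by simp)
    exact ⟨this.2, this.1.of_dilate hp hpB⟩
  have hsymm : ∀ r, r.Prime → r ∣ B.card → r ∣ A.card → r = u ∨ r = v :=
    fun r hr h1 h2 => huv r hr h2 h1
  rcases Nat.eq_or_lt_of_le (Nat.succ_le_of_lt hM) with h1 | h1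
  · have := mul_eq_one.1 (h.1.trans h1.symm)
    exact ⟨natT2_of_card_eq_one this.1, natT2_of_card_eq_one this.2⟩
  by_cases hB : ∃ p, p.Prime ∧ p ∣ M ∧ ¬ p ∣ B.card
  · obtain ⟨p, hp, hpM, hpB⟩ := hB
    exact hndvd h huv hp hpM hpB
  by_cases hA : ∃ p, p.Prime ∧ p ∣ M ∧ ¬ p ∣ A.card
  · obtain ⟨p, hp, hpM, hpA⟩ := hA
    exact (hndvd h.symm hsymm hp hpM hpA).symm
  push Not at hA hB
  obtain ⟨p, c, hp, hpM, hc | hc⟩ := h.exists_mod_eq h1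
    fun r hr hrM => huv r hr (hA r hr hrM) (hB r hr hrM)
  · exact hclass h huv hp hpM hc
  · exact (hclass h.symm hsymm hp hpM hc).symm

/-! ### Passage from `ZMod M` to natural representatives -/

section ZMod

variable {M : ℕ} [NeZero M]

theorem card_image_val (A : Finset (ZMod M)) : (A.image ZMod.val).card = A.card :=
  card_image_of_injective _ (ZMod.val_injective M)

theorem natMask_image_val (A : Finset (ZMod M)) : natMask (A.image ZMod.val) = maskPoly A := by
  rw [natMask, maskPoly, sum_image (ZMod.val_injective M).injOn]

theorem IsTiling.card_mul_card {A B : Finset (ZMod M)} (h : IsTiling A B) :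
    A.card * B.card = M := by
  have := Nat.card_eq_of_bijective _ h
  simpa [Nat.card_prod] using this

theorem IsTiling.tiles {A B : Finset (ZMod M)} (h : IsTiling A B) :
    Tiles M (A.image ZMod.val) (B.image ZMod.val) := by
  refine ⟨by rw [card_image_val, card_image_val, h.card_mul_card], ?_⟩
  simp only [forall_mem_image]
  intro a ha a' ha' b hb b' hb' hab
  rw [← ZMod.natCast_eq_natCast_iff] at hab
  simp only [Nat.cast_add, ZMod.natCast_val, ZMod.cast_id', id_eq] at hab
  have := @h.1 (⟨a, ha⟩, ⟨b, hb⟩) (⟨a', ha'⟩, ⟨b', hb'⟩) hab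
  simp only [Prod.mk.injEq, Subtype.mk.injEq] at this
  rw [this.1, this.2]
  exact ⟨rfl, rfl⟩

theorem satisfiesT2_of_natT2 {A : Finset (ZMod M)} (h : NatT2 (A.image ZMod.val)) :
    SatisfiesT2 A := by
  intro P α hP hprime hS
  have hα : ∀ q ∈ P, α q ≠ 0 := fun q hq h0 => by
    have := (hS q hq).1
    rw [h0, pow_zero] at this
    exact this.ne_one rfl
  have hfac : ∀ q ∈ P, (∏ q ∈ P, q ^ α q).factorization q = α q := fun q hq => by
    rw [Nat.factorization_prod_apply fun r hr => pow_ne_zero _ (hprime r hr).ne_zero,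
      sum_eq_single_of_mem q hq]
    · simp [(hprime q hq).factorization_self]
    · intro r hr hrq
      simp [(hprime r hr).factorization, Finsupp.single_eq_of_ne hrq.symm]
  rw [← natMask_image_val]
  refine h _ ?_ fun q hq hqs => ?_
  · obtain ⟨q, hq⟩ := hP
    exact (Nat.one_lt_pow (hα q hq) (hprime q hq).one_lt).trans_le
      (Nat.le_of_dvd (prod_pos fun r hr => pow_pos (hprime r hr).pos _)
        (dvd_prod_of_mem (fun r => r ^ α r) hq))
  · obtain ⟨r, hr, hqr⟩ := (hq.prime.dvd_finsetProd_iff _).1 hqs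
    have hqP : q ∈ P :=
      (Nat.prime_dvd_prime_iff_eq hq (hprime r hr)).1 (hq.dvd_of_dvd_pow hqr) ▸ hr
    rw [hfac q hqP, natMask_image_val]
    exact (hS q hqP).2

end ZMod

end CyclicTiling

theorem mainTheorem6 (K : ℕ) (p n : Fin K → ℕ)
    (hp : ∀ i, (p i).Prime) (hinj : Function.Injective p) (hn : ∀ i, 0 < n i)
    (M : ℕ) (hM : M = ∏ i, p i ^ n i)
    (A B : Finset (ZMod M)) (hAB : CyclicTiling.IsTiling A B) :
    ((∀ i : Fin K, 2 ≤ (i : ℕ) → ¬ (p i ∣ A.card ∧ p i ∣ B.card)) →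
      CyclicTiling.SatisfiesT2 A ∧ CyclicTiling.SatisfiesT2 B) ∧
    ((∀ i : Fin K, 2 ≤ (i : ℕ) → n i = 1) →
      ∀ i : Fin K, 2 ≤ (i : ℕ) → ¬ (p i ∣ A.card ∧ p i ∣ B.card)) := by
  have hMpos : 0 < M := hM ▸ Finset.prod_pos fun i _ => pow_pos (hp i).pos _
  have : NeZero M := ⟨hMpos.ne'⟩
  have hcard := hAB.card_mul_card
  constructor
  · intro h
    -- The value `0` fills in for missing primes when `K < 2`; `u` and `v` need not be prime.
    let f : ℕ → ℕ := fun k => if hk : k < K then p ⟨k, hk⟩ else 0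
    have := hAB.tiles.natT2 (u := f 0) (v := f 1) hMpos fun r hr hrA hrB => by
      rw [CyclicTiling.card_image_val] at hrA hrB
      have hrM : r ∣ ∏ i, p i ^ n i := hM ▸ hcard ▸ dvd_mul_of_dvd_left hrA _
      obtain ⟨i, -, hi⟩ := (hr.prime.dvd_finsetProd_iff _).1 hrM
      obtain rfl := (Nat.prime_dvd_prime_iff_eq hr (hp i)).1 (hr.dvd_of_dvd_pow hi)
      have hi2 : (i : ℕ) < 2 := by
        by_contra! hi2
        exact h i hi2 ⟨hrA, hrB⟩
      have hfi : f i = p i := dif_pos i.2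
      rcases (by omega : (i : ℕ) = 0 ∨ (i : ℕ) = 1) with h0 | h0
      · exact Or.inl (by rw [← hfi, h0])
      · exact Or.inr (by rw [← hfi, h0])
    exact ⟨CyclicTiling.satisfiesT2_of_natT2 this.1, CyclicTiling.satisfiesT2_of_natT2 this.2⟩
  · rintro h i hi ⟨hA, hB⟩
    -- A common prime would have its square dividing `M`, against exponent one.
    have hdvd : p i ^ 2 ∣ ∏ j, p j ^ n j := by
      rw [← hM, ← hcard, pow_two]
      exact mul_dvd_mul hA hB
    rw [← Finset.mul_prod_erase _ _ (Finset.mem_univ i), h i hi, pow_one, pow_two] at hdvd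
    obtain ⟨j, hj, hij⟩ := ((hp i).prime.dvd_finsetProd_iff _).1
      (Nat.dvd_of_mul_dvd_mul_left (hp i).pos hdvd)
    exact Finset.ne_of_mem_erase hj (hinj
      ((Nat.prime_dvd_prime_iff_eq (hp i) (hp j)).1 ((hp i).dvd_of_dvd_pow hij))).symm
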